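/- Let $K$ be an infinite field and let $n,r$ be natural numbers with $n\ge 1$. Let $I(\mathbb Z,r)$ be the set of $r$-tuples of integers. The extended affine Weyl group $\widehat\Sigma_r=\Sigma_r\ltimes\mathbb Z^r$ acts on the right on $I(\mathbb Z,r)$, where $\Sigma_r$ permutes places and $\varepsilon\in\mathbb Z^r$ acts by $\underline i\mapsto \underline i+n\varepsilon$; it acts diagonally on $I(\mathbb Z,r)\times I(\mathbb Z,r)$, and $\sim$ denotes lying in the same orbit of this diagonal action. The affine Schur algebra $\widetilde S(n,r)$ is the unital associative $K$-algebra with a basis indexed by the $\widehat\Sigma_r$-orbits on $I(\mathbb Z,r)\times I(\mathbb Z,r)$, the basis element of the orbit of $(\underline i,\underline j)$ being written $\xi_{\underline i,\underline j}$, and with multiplication \[ \xi_{\underline i,\underline j}\,\xi_{\underline k,\underline l}=\sum_{(\underline p,\underline q)} \#\{\underline s\in I(\mathbb Z,r) : (\underline i,\underline j)\sim(\underline p,\underline s),\ (\underline s,\underline q)\sim(\underline k,\underline l)\}\ \xi_{\underline p,\underline q}, \] where $(\underline p,\underline q)$ runs over representatives of the $\widehat\Sigma_r$-orbits on $I(\mathbb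 Z,r)\times I(\mathbb Z,r)$. Now let $r=n+1$ and let $\underline v=(1,1,2,\dots,n)\in I(\mathbb Z,n+1)$. Then $\xi_{\underline v,\underline v}$ is an idempotent; put $\widetilde S(\underline v)=\xi_{\underline v,\underline v}\,\widetilde S(n,n+1)\,\xi_{\underline v,\underline v}$, a $K$-algebra with identity $\xi_{\underline v,\underline v}$. **Theorem.** If $\operatorname{char}K=0$ or $\operatorname{char}K>n+1$, then $\widetilde S(n,n+1)$ is Morita equivalent to $\widetilde S(\underline v)$, that is, their categories of modules are equivalent as $K$-linear categories. -/

import Mathlib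

namespace AffineSchur

/-- The set `I(ℤ, r)` of `r`-tuples of integers. -/
abbrev Tuple (r : ℕ) : Type := Fin r → ℤ

/-- The right action of the element `σ ε` of the extended affine Weyl group
`Σ_r ⋉ ℤ^r` on `I(ℤ, r)`: permute places by `σ`, then shift by `n ε`. Every element of the
group has exactly one expression `σ ε` with `σ ∈ Σ_r` and `ε ∈ ℤ^r`. -/
def act {r : ℕ} (n : ℕ) (σ : Equiv.Perm (Fin r)) (ε : Fin r → ℤ) (i : Tuple r) : Tuple r :=
  fun t => i (σ t) + n * ε t

/-- Two pairs of tuples are related when they lie in the same orbit of the diagonal action of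
the extended affine Weyl group. -/
def pairSetoid (n r : ℕ) : Setoid (Tuple r × Tuple r) where
  r x y := ∃ (σ : Equiv.Perm (Fin r)) (ε : Fin r → ℤ), y.1 = act n σ ε x.1 ∧ y.2 = act n σ ε x.2
  iseqv :=
    { refl := fun x => ⟨1, 0, by funext t; simp [act], by funext t; simp [act]⟩
      symm := by
        rintro x y ⟨σ, ε, h1, h2⟩
        refine ⟨σ⁻¹, fun t => - ε (σ⁻¹ t), ?_, ?_⟩
        · funext t; simp [h1, act]
        · funext t; simp [h2, act]
      trans := by
        rintro x y z ⟨σ, ε, h1, h2⟩ ⟨τ, δ, h3, h4⟩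
        refine ⟨σ * τ, fun t => ε (τ t) + δ t, ?_, ?_⟩
        · funext t; simp [h1, h3, act]; ring
        · funext t; simp [h2, h4, act]; ring }

/-- The set of orbits of the extended affine Weyl group on `I(ℤ, r) × I(ℤ, r)`. -/
def Orbit (n r : ℕ) : Type := Quotient (pairSetoid n r)

/-- The orbit of `(i, j)`. -/
def orb (n : ℕ) {r : ℕ} (i j : Tuple r) : Orbit n r := Quotient.mk (pairSetoid n r) (i, j)

theorem orb_eq_iff {n r : ℕ} {i j k l : Tuple r} :
    orb n i j = orb n k l ↔
      ∃ (σ : Equiv.Perm (Fin r)) (ε : Fin r → ℤ), k = act n σ ε i ∧ l = act n σ ε j :=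
  Quotient.eq (r := pairSetoid n r) (x := (i, j)) (y := (k, l))

theorem exists_orb {n r : ℕ} (c : Orbit n r) : ∃ i j, c = orb n i j :=
  Quotient.inductionOn c fun x => ⟨x.1, x.2, rfl⟩

theorem orb_act {n r : ℕ} (σ : Equiv.Perm (Fin r)) (ε : Fin r → ℤ) (i j : Tuple r) :
    orb n (act n σ ε i) (act n σ ε j) = orb n i j :=
  (orb_eq_iff.2 ⟨σ, ε, rfl, rfl⟩).symm

/-- Each element of the extended affine Weyl group acts as a bijection. -/
def actEquiv {r : ℕ} (n : ℕ) (σ : Equiv.Perm (Fin r)) (ε : Fin r → ℤ) : Tuple r ≃ Tuple r where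
  toFun := act n σ ε
  invFun i := fun t => i (σ⁻¹ t) - n * ε (σ⁻¹ t)
  left_inv i := by funext t; simp [act]
  right_inv i := by funext t; simp [act]

/-- The tuples `s` with `(p, s)` in the orbit `a` and `(s, q)` in the orbit `b`. -/
def middleSet {n r : ℕ} (a b : Orbit n r) (p q : Tuple r) : Set (Tuple r) :=
  {s | orb n p s = a ∧ orb n s q = b}

/-- The structure constant `Z(i, j, k, l, p, q)`, where `a`, `b`, `c` are the orbits of
`(i, j)`, `(k, l)`, `(p, q)`: the number of tuples `s` with `(i, j) ∼ (p, s)` and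
`(s, q) ∼ (k, l)`. -/
noncomputable def structConst {n r : ℕ} (a b c : Orbit n r) : ℕ :=
  Quotient.liftOn c (fun x => (middleSet a b x.1 x.2).ncard) (by
    rintro ⟨p, q⟩ ⟨p', q'⟩ ⟨σ, ε, h1, h2⟩
    have h1' : p' = act n σ ε p := h1
    have h2' : q' = act n σ ε q := h2
    subst h1' h2'
    refine Set.ncard_congr (fun s _ => actEquiv n σ ε s) ?_ ?_ ?_
    · rintro s ⟨hs, hs'⟩
      exact ⟨(orb_act σ ε p s).trans hs, (orb_act σ ε s q).trans hs'⟩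
    · intro s s' _ _ h
      exact (actEquiv n σ ε).injective h
    · rintro s ⟨hs, hs'⟩
      obtain ⟨u, rfl⟩ := (actEquiv n σ ε).surjective s
      exact ⟨u, ⟨(orb_act σ ε p u).symm.trans hs, (orb_act σ ε u q).symm.trans hs'⟩, rfl⟩)

theorem structConst_orb {n r : ℕ} (a b : Orbit n r) (p q : Tuple r) :
    structConst a b (orb n p q) = (middleSet a b p q).ncard := rfl

theorem finite_right {n r : ℕ} (a : Orbit n r) (p : Tuple r) : {s | orb n p s = a}.Finite := by
  obtain ⟨i, j, rfl⟩ := exists_orb a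
  refine (Set.finite_range fun σ : Equiv.Perm (Fin r) =>
    (fun t => j (σ t) + (p t - i (σ t)) : Tuple r)).subset ?_
  intro s hs
  obtain ⟨σ, ε, h1, h2⟩ := orb_eq_iff.1 (Eq.symm hs)
  exact ⟨σ, by funext t; simp [h1, h2, act]⟩

theorem finite_left {n r : ℕ} (a : Orbit n r) (q : Tuple r) : {s | orb n s q = a}.Finite := by
  obtain ⟨i, j, rfl⟩ := exists_orb a
  refine (Set.finite_range fun σ : Equiv.Perm (Fin r) =>
    (fun t => i (σ t) + (q t - j (σ t)) : Tuple r)).subset ?_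
  intro s hs
  obtain ⟨σ, ε, h1, h2⟩ := orb_eq_iff.1 (Eq.symm hs)
  exact ⟨σ, by funext t; simp [h1, h2, act]⟩

theorem finite_middleSet {n r : ℕ} (a b : Orbit n r) (p q : Tuple r) :
    (middleSet a b p q).Finite :=
  (finite_right a p).subset fun _ h => h.1

theorem finite_structConst {n r : ℕ} (a b : Orbit n r) :
    {c | structConst a b c ≠ 0}.Finite := by
  obtain ⟨i, j, rfl⟩ := exists_orb a
  refine ((finite_right b j).image (orb n i)).subset ?_
  intro c hc
  obtain ⟨p, q, rfl⟩ := exists_orb c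
  obtain ⟨s, hs, hs'⟩ := Set.nonempty_of_ncard_ne_zero hc
  obtain ⟨σ, ε, h1, h2⟩ := orb_eq_iff.1 hs
  have hq : orb n j (act n σ ε q) = orb n s q := by rw [h2, orb_act]
  exact ⟨act n σ ε q, hq.trans hs', by rw [h1, orb_act]⟩

section Algebra

variable (K : Type*) [Field K] (n r : ℕ)

/-- The underlying vector space of the affine Schur algebra: it has a basis indexed by the orbits
of the extended affine Weyl group on `I(ℤ, r) × I(ℤ, r)`. -/
def SchurAlgebra : Type _ := Orbit n r →₀ K

noncomputable instance : AddCommGroup (SchurAlgebra K n r) :=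
  inferInstanceAs (AddCommGroup (Orbit n r →₀ K))

noncomputable instance : Module K (SchurAlgebra K n r) :=
  inferInstanceAs (Module K (Orbit n r →₀ K))

variable {n r}

variable {K} in
/-- The coefficient of an element at the basis element of the orbit `c`. -/
def coeff (f : SchurAlgebra K n r) (c : Orbit n r) : K := (show Orbit n r →₀ K from f) c

/-- The basis element of the orbit `a`. -/
noncomputable def basisElt (a : Orbit n r) : SchurAlgebra K n r :=
  (Finsupp.single a (1 : K) : Orbit n r →₀ K)

/-- The basis element `ξ_{i,j}`. -/
noncomputable def xi (i j : Tuple r) : SchurAlgebra K n r := basisElt K (orb n i j)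

variable {K} in
theorem ext_coeff {f g : SchurAlgebra K n r} (h : ∀ c, coeff f c = coeff g c) : f = g :=
  Finsupp.ext (M := K) h

open Classical in
theorem coeff_basisElt (a c : Orbit n r) :
    coeff (basisElt K a) c = if a = c then 1 else 0 :=
  Finsupp.single_apply

theorem hom_ext_basisElt {M : Type*} [AddCommMonoid M] [Module K M]
    {F G : SchurAlgebra K n r →ₗ[K] M} (h : ∀ a, F (basisElt K a) = G (basisElt K a)) : F = G :=
  Finsupp.lhom_ext' (φ := F) (ψ := G) fun a => LinearMap.ext_ring (h a)

/-- The linear map with prescribed values on the basis elements. -/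
noncomputable def lift {M : Type*} [AddCommMonoid M] [Module K M] (φ : Orbit n r → M) :
    SchurAlgebra K n r →ₗ[K] M :=
  (Finsupp.linearCombination K φ : (Orbit n r →₀ K) →ₗ[K] M)

theorem lift_basisElt {M : Type*} [AddCommMonoid M] [Module K M] (φ : Orbit n r → M)
    (a : Orbit n r) : lift K φ (basisElt K a) = φ a :=
  (Finsupp.linearCombination_single K (1 : K) a).trans (one_smul K _)

/-- The product of the basis elements of two orbits `a` and `b`: the sum over all orbits `c` of
the structure constant times the basis element of `c`. -/
noncomputable def basisMul (a b : Orbit n r) : SchurAlgebra K n r :=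
  Finsupp.ofSupportFinite (fun c => (structConst a b c : K))
    ((finite_structConst a b).subset fun c hc h => hc (by simp [h]))

theorem coeff_basisMul (a b c : Orbit n r) : coeff (basisMul K a b) c = structConst a b c := rfl

/-- The multiplication: the bilinear extension of `basisMul`. -/
noncomputable def mulBilin :
    SchurAlgebra K n r →ₗ[K] SchurAlgebra K n r →ₗ[K] SchurAlgebra K n r :=
  lift K fun a => lift K fun b => basisMul K a b

noncomputable instance : Mul (SchurAlgebra K n r) := ⟨fun f g => mulBilin K f g⟩

/-- The orbits of the pairs `(i, i)`. -/
def diagonal (n r : ℕ) : Set (Orbit n r) := Set.range fun i : Tuple r => orb n i i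

theorem orb_mem_diagonal {p q : Tuple r} : orb n p q ∈ diagonal n r ↔ p = q := by
  constructor
  · rintro ⟨i, hi⟩
    obtain ⟨σ, ε, h1, h2⟩ := orb_eq_iff.1 hi
    rw [h1, h2]
  · rintro rfl
    exact ⟨p, rfl⟩

theorem finite_diagonal (n r : ℕ) [NeZero n] : (diagonal n r).Finite := by
  have hn : (n : ℤ) ≠ 0 := by exact_mod_cast NeZero.ne n
  have hn' : (0 : ℤ) < n := by have := NeZero.pos n; exact_mod_cast this
  refine (Set.finite_range fun u : Fin r → Fin n =>
    orb n (fun t => ((u t : ℕ) : ℤ)) (fun t => ((u t : ℕ) : ℤ))).subset ?_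
  rintro _ ⟨i, rfl⟩
  have key : (fun t => (((i t % n).toNat : ℕ) : ℤ)) = act n 1 (fun t => - (i t / n)) i := by
    funext t
    have h1 := Int.emod_nonneg (i t) hn
    have h2 := Int.emod_add_mul_ediv (i t) n
    simp only [act, Int.toNat_of_nonneg h1, Equiv.Perm.coe_one, id]
    linarith
  refine ⟨fun t => ⟨(i t % n).toNat, ?_⟩, ?_⟩
  · have h1 := Int.emod_nonneg (i t) hn
    have h2 := Int.emod_lt_of_pos (i t) hn'
    omega
  · simp only [key, orb_act]

open Classical in
/-- The identity: the sum of the elements `ξ_{i,i}`, one for each orbit of tuples. -/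
noncomputable instance [NeZero n] : One (SchurAlgebra K n r) :=
  ⟨Finsupp.ofSupportFinite (fun c => if c ∈ diagonal n r then (1 : K) else 0)
    ((finite_diagonal n r).subset fun c hc => by
      by_contra h
      exact hc (if_neg h))⟩

/-- The column of index `q` of an element, regarded as an infinite matrix over `I(ℤ, r)`. -/
noncomputable def column (q : Tuple r) : SchurAlgebra K n r →ₗ[K] (Tuple r →₀ K) where
  toFun f := Finsupp.ofSupportFinite
    (fun p => coeff f (orb n p q)) (by
      refine (Set.Finite.biUnion (show Orbit n r →₀ K from f).support.finite_toSet
        (fun a _ => finite_left a q)).subset ?_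
      intro p hp
      simp only [Set.mem_iUnion]
      exact ⟨orb n p q, Finsupp.mem_support_iff.2 hp, rfl⟩)
  map_add' f g := by ext p; rfl
  map_smul' c f := by ext p; rfl

/-- The action of the affine Schur algebra on the vector space with basis `I(ℤ, r)`. -/
noncomputable def toEnd : SchurAlgebra K n r →ₗ[K] Module.End K (Tuple r →₀ K) where
  toFun f := Finsupp.linearCombination K fun q => column K q f
  map_add' f g := by ext q : 1; ext; simp
  map_smul' c f := by ext q : 1; ext; simp

theorem toEnd_single (f : SchurAlgebra K n r) (p q : Tuple r) :
    toEnd K f (Finsupp.single q 1) p = coeff f (orb n p q) := by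
  simp only [toEnd, LinearMap.coe_mk, AddHom.coe_mk, Finsupp.linearCombination_single, one_smul]
  rfl

theorem toEnd_injective : Function.Injective (toEnd K : SchurAlgebra K n r →ₗ[K] _) := by
  intro f g h
  refine ext_coeff fun c => ?_
  obtain ⟨p, q, rfl⟩ := exists_orb c
  have h2 := toEnd_single K f p q
  rw [h, toEnd_single] at h2
  exact h2.symm

theorem mulBilin_basisElt (a b : Orbit n r) :
    mulBilin K (basisElt K a) (basisElt K b) = basisMul K a b := by
  rw [mulBilin, lift_basisElt, lift_basisElt]

theorem toEnd_basisMul (a b : Orbit n r) :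
    toEnd K (basisMul K a b) =
      toEnd K (basisElt K a) *
        toEnd K (basisElt K b) := by
  classical
  refine Finsupp.lhom_ext' fun q => LinearMap.ext_ring (Finsupp.ext fun p => ?_)
  simp only [LinearMap.comp_apply, Finsupp.lsingle_apply, Module.End.mul_apply]
  rw [toEnd_single]
  have hcol : toEnd K (basisElt K b) (Finsupp.single q 1) =
      ∑ s ∈ (finite_left b q).toFinset, Finsupp.single s (1 : K) := by
    ext s
    rw [toEnd_single]
    rw [coeff_basisElt, Finsupp.finsetSum_apply]
    simp [Finsupp.single_apply, eq_comm]
  rw [hcol, map_sum, Finsupp.finsetSum_apply]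
  simp only [toEnd_single, coeff_basisElt, coeff_basisMul, Finset.sum_boole]
  rw [structConst_orb, Set.ncard_eq_toFinset_card _ (finite_middleSet a b p q)]
  congr 2
  ext s
  simp [middleSet, and_comm, eq_comm]

theorem toEnd_mul (f g : SchurAlgebra K n r) : toEnd K (f * g) = toEnd K f * toEnd K g := by
  have h : (mulBilin K (n := n) (r := r)).compr₂ (toEnd K) =
      (LinearMap.mul K (Module.End K (Tuple r →₀ K))).compl₁₂ (toEnd K) (toEnd K) := by
    refine hom_ext_basisElt K fun a => hom_ext_basisElt K fun b => ?_
    change toEnd K (mulBilin K (basisElt K a) (basisElt K b)) = _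
    rw [mulBilin_basisElt, toEnd_basisMul]
    rfl
  exact LinearMap.congr_fun₂ h f g

theorem toEnd_one [NeZero n] : toEnd K (1 : SchurAlgebra K n r) = 1 := by
  classical
  refine Finsupp.lhom_ext' fun q => LinearMap.ext_ring (Finsupp.ext fun p => ?_)
  simp only [LinearMap.comp_apply, Finsupp.lsingle_apply, Module.End.one_apply]
  rw [toEnd_single]
  change (if orb n p q ∈ diagonal n r then (1 : K) else 0) = _
  simp [orb_mem_diagonal, Finsupp.single_apply, eq_comm]

noncomputable instance [NeZero n] : Ring (SchurAlgebra K n r) where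
  __ := (inferInstance : AddCommGroup (SchurAlgebra K n r))
  mul := (· * ·)
  one := 1
  left_distrib f g h := map_add (mulBilin K f) g h
  right_distrib f g h := by
    change mulBilin K (f + g) h = _
    rw [map_add]
    rfl
  zero_mul f := by
    change mulBilin K 0 f = 0
    rw [map_zero]
    rfl
  mul_zero f := map_zero (mulBilin K f)
  mul_assoc f g h := toEnd_injective K (by simp only [toEnd_mul, mul_assoc])
  one_mul f := toEnd_injective K (by simp only [toEnd_mul, toEnd_one, one_mul])
  mul_one f := toEnd_injective K (by simp only [toEnd_mul, toEnd_one, mul_one])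

/-- The affine Schur algebra is a `K`-algebra. -/
noncomputable instance [NeZero n] : Algebra K (SchurAlgebra K n r) :=
  Algebra.ofModule
    (fun c f g => by
      change mulBilin K (c • f) g = c • mulBilin K f g
      rw [map_smul]
      rfl)
    (fun c f g => map_smul (mulBilin K f) c g)

theorem xi_mul_xi [NeZero n] (i j k l : Tuple r) :
    xi K (n := n) i j * xi K k l = basisMul K (orb n i j) (orb n k l) :=
  mulBilin_basisElt K _ _

theorem xi_idempotent [NeZero n] (i : Tuple r) :
    IsIdempotentElem (xi K i i : SchurAlgebra K n r) := by
  classical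
  refine (xi_mul_xi K i i i i).trans (ext_coeff fun c => ?_)
  obtain ⟨p, q, rfl⟩ := exists_orb c
  rw [coeff_basisMul, structConst_orb, xi, coeff_basisElt]
  have diag : ∀ {x y : Tuple r}, orb n x y = orb n i i → x = y := fun h =>
    orb_mem_diagonal.1 ⟨i, h.symm⟩
  by_cases h : orb n i i = orb n p q
  · obtain rfl := diag h.symm
    have hs : middleSet (orb n i i) (orb n i i) p p = {p} := by
      ext s
      simp only [middleSet, Set.mem_ofPred_eq, Set.mem_singleton_iff]
      exact ⟨fun hs => (diag hs.1).symm, by rintro rfl; exact ⟨h.symm, h.symm⟩⟩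
    rw [hs, if_pos h]
    simp
  · have hs : middleSet (orb n i i) (orb n i i) p q = ∅ := by
      refine Set.eq_empty_of_forall_notMem fun s hs => h ?_
      obtain rfl := diag hs.1
      exact hs.2.symm
    rw [hs, if_neg h]
    simp

end Algebra

/-- For an idempotent `e` of a `K`-algebra `A`, the ring `e A e` (with identity `e`) is a
`K`-algebra, with scalar multiplication restricted from `A`. -/
noncomputable instance cornerAlgebra {K A : Type*} [Field K] [Ring A] [Algebra K A] {e : A}
    (he : IsIdempotentElem e) : Algebra K he.Corner :=
  letI : SMul K he.Corner := ⟨fun c x => ⟨c • x.1, by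
    obtain ⟨a, ha⟩ := x.2
    exact ⟨c • a, by simp [← ha]⟩⟩⟩
  letI : Module K he.Corner :=
    { one_smul := fun x => Subtype.ext (one_smul K x.1)
      mul_smul := fun c d x => Subtype.ext (mul_smul c d x.1)
      smul_zero := fun c => Subtype.ext (smul_zero c)
      smul_add := fun c x y => Subtype.ext (smul_add c x.1 y.1)
      add_smul := fun c d x => Subtype.ext (add_smul c d x.1)
      zero_smul := fun x => Subtype.ext (zero_smul K x.1) }
  Algebra.ofModule
    (fun c x y => Subtype.ext (smul_mul_assoc c x.1 y.1))
    (fun c x y => Subtype.ext (mul_smul_comm c x.1 y.1))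

/-- The centralizer algebra `S̃(i) = ξ_{i,i} S̃(n, r) ξ_{i,i}`. -/
abbrev Centralizer (K : Type*) [Field K] {n r : ℕ} [NeZero n] (i : Tuple r) : Type _ :=
  (xi_idempotent K (n := n) i).Corner

/-- The tuple `v = (1, 1, 2, …, n)` of length `n + 1`. -/
def vTuple (n : ℕ) : Tuple (n + 1) := fun t => max 1 (t : ℕ)

end AffineSchur

/-! An algebra `A` is Morita equivalent to `e A e` as soon as the idempotent `e` is full, meaning `1
= ∑ xᵢ e yᵢ`; the equivalence is `M ↦ e M`. So it suffices to show that `e = ξ_{v,v}` is full.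

The identity is the sum of the `ξ_{i,i}`, one for each orbit of tuples (`one_eq_sum_xi`). A tuple
has `n + 1` entries and there are `n` residues mod `n`, so two entries are congruent and each orbit
contains some `i` whose first two entries are equal (`exists_orb_diagonal_eq`). The stabilizer of
`v` only swaps the first two places, so it fixes this `i` (`act_eq_of_act_vTuple_eq`). This
containment of stabilizers gives `ξ_{i,v} ξ_{v,i} = N ξ_{i,i}` (`xi_mul_xi_swap`), where `N` is the
size of the orbit of `v` under the stabilizer of `i`. As `N` divides `(n + 1)!`
(`ncard_orb_dvd_factorial`), it is invertible in `K`, and `ξ_{i,i} = N⁻¹ ξ_{i,v} e ξ_{v,i}`. -/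

open CategoryTheory

namespace IsIdempotentElem

universe u v w

/-! ### Modules over a ring and over its corner at an idempotent. -/

section Modules

variable {A : Type v} [Ring A] {e : A}

theorem mul_corner (he : IsIdempotentElem e) (c : he.Corner) : e * c.1 = c.1 :=
  ((Subsemigroup.mem_corner_iff he).mp c.2).1

theorem corner_mul (he : IsIdempotentElem e) (c : he.Corner) : c.1 * e = c.1 :=
  ((Subsemigroup.mem_corner_iff he).mp c.2).2

/-- The element `e a e` of the corner ring. -/
def toCorner (he : IsIdempotentElem e) (a : A) : he.Corner := ⟨e * a * e, a, rfl⟩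

/-- The subgroup `e M` of a module `M`, as the set of fixed points of the idempotent `e`. -/
def fixedPart (_ : IsIdempotentElem e) (M : Type w) [AddCommGroup M] [Module A M] :
    AddSubgroup M where
  carrier := {m | e • m = m}
  add_mem' {x y} hx hy := by
    change e • (x + y) = x + y
    rw [smul_add, hx, hy]
  zero_mem' := smul_zero e
  neg_mem' {x} hx := by
    change e • (-x) = -x
    rw [smul_neg, hx]

section FixedPart

variable (he : IsIdempotentElem e) {M : Type w} [AddCommGroup M] [Module A M]

theorem smul_fixedPart (m : he.fixedPart M) : e • m.1 = m.1 := m.2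

theorem smul_mem_fixedPart {a : A} (ha : e * a = a) (m : M) : a • m ∈ he.fixedPart M := by
  change e • a • m = a • m
  rw [smul_smul, ha]

instance : Module he.Corner (he.fixedPart M) where
  smul c m := ⟨c.1 • m.1, he.smul_mem_fixedPart (he.mul_corner c) m.1⟩
  one_smul m := Subtype.ext m.2
  mul_smul c d m := Subtype.ext (mul_smul c.1 d.1 m.1)
  smul_zero c := Subtype.ext (smul_zero c.1)
  smul_add c x y := Subtype.ext (smul_add c.1 x.1 y.1)
  add_smul c d m := Subtype.ext (add_smul c.1 d.1 m.1)
  zero_smul m := Subtype.ext (zero_smul A m.1)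

theorem coe_corner_smul (c : he.Corner) (m : he.fixedPart M) : (c • m).1 = c.1 • m.1 := rfl

/-- The restriction of a linear map `M → N` to a map `e M → e N`. -/
def fixedPartMap {N : Type w} [AddCommGroup N] [Module A N] (f : M →ₗ[A] N) :
    he.fixedPart M →ₗ[he.Corner] he.fixedPart N where
  toFun m := ⟨f m.1, by
    change e • f m.1 = f m.1
    rw [← map_smul, he.smul_fixedPart]⟩
  map_add' x y := Subtype.ext (map_add f x.1 y.1)
  map_smul' c x := Subtype.ext (map_smul f c.1 x.1)

end FixedPart

/-- The `e A e`-linear maps from `e A` to a module `N` over the corner ring `e A e`. Such a map is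
given by its composite with the projection `A → e A`. -/
def coind (he : IsIdempotentElem e) (N : Type w) [AddCommGroup N] [Module he.Corner N] :
    AddSubgroup (A →+ N) where
  carrier := {φ | ∀ (c : he.Corner) (x : A), φ (c.1 * x) = c • φ x}
  add_mem' {φ ψ} hφ hψ c x := by
    rw [AddMonoidHom.add_apply, AddMonoidHom.add_apply, hφ, hψ, smul_add]
  zero_mem' c _ := (smul_zero c).symm
  neg_mem' {φ} hφ c x := by
    rw [AddMonoidHom.neg_apply, AddMonoidHom.neg_apply, hφ, smul_neg]

section Coind

variable (he : IsIdempotentElem e) {N : Type w} [AddCommGroup N] [Module he.Corner N]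

theorem coind_ext {φ ψ : he.coind N} (h : ∀ x, φ.1 x = ψ.1 x) : φ = ψ :=
  Subtype.ext (AddMonoidHom.ext h)

instance : Module A (he.coind N) where
  smul a φ := ⟨φ.1.comp (AddMonoidHom.mulRight a), fun c x => by
    change φ.1 (c.1 * x * a) = c • φ.1 (x * a)
    rw [mul_assoc, φ.2]⟩
  one_smul φ := he.coind_ext fun x => congrArg φ.1 (mul_one x)
  mul_smul a b φ := he.coind_ext fun x => congrArg φ.1 (mul_assoc x a b).symm
  smul_zero _ := he.coind_ext fun _ => rfl
  smul_add _ _ _ := he.coind_ext fun _ => rfl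
  add_smul a b φ := he.coind_ext fun x =>
    (congrArg φ.1 (mul_add x a b)).trans (map_add φ.1 _ _)
  zero_smul φ := he.coind_ext fun x => (congrArg φ.1 (mul_zero x)).trans (map_zero φ.1)

theorem coe_smul_coind (a : A) (φ : he.coind N) (x : A) : (a • φ).1 x = φ.1 (x * a) := rfl

theorem coind_apply_mul (φ : he.coind N) (x : A) : φ.1 (e * x) = φ.1 x := by
  have h := φ.2 1 x
  rwa [one_smul] at h

/-- The `e`-fixed part of the module of maps from `e A` to `N` is `N`. -/
def fixedPartCoindEquiv : he.fixedPart (he.coind N) ≃ₗ[he.Corner] N where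
  toFun φ := φ.1.1 e
  map_add' _ _ := rfl
  map_smul' c φ := by
    have h := φ.1.2 c e
    rw [he.corner_mul] at h
    change φ.1.1 (e * c.1) = c • φ.1.1 e
    rw [he.mul_corner, h]
  invFun y := ⟨⟨
    { toFun := fun x => he.toCorner x • y
      map_zero' := by
        rw [show he.toCorner 0 = 0 from Subtype.ext (by
          change e * 0 * e = 0
          rw [mul_zero, zero_mul])]
        exact zero_smul he.Corner y
      map_add' := fun a b => by
        rw [← add_smul]
        congr 1
        refine Subtype.ext ?_
        change e * (a + b) * e = e * a * e + e * b * e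
        rw [mul_add, add_mul] }, fun c x => by
      change he.toCorner (c.1 * x) • y = c • he.toCorner x • y
      rw [smul_smul]
      congr 1
      refine Subtype.ext ?_
      change e * (c.1 * x) * e = c.1 * (e * x * e)
      rw [← mul_assoc e, he.mul_corner, ← mul_assoc, ← mul_assoc, he.corner_mul]⟩, by
    refine he.coind_ext fun x => ?_
    change he.toCorner (x * e) • y = he.toCorner x • y
    congr 1
    refine Subtype.ext ?_
    change e * (x * e) * e = e * x * e
    rw [← mul_assoc, mul_assoc, he.eq]⟩
  -- Being fixed by `e` means `φ (x e) = φ x`, and always `φ (e x) = φ x`; hence `φ x = φ ((e x e)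
  -- e) = (e x e) • φ e`.
  left_inv φ := by
    refine Subtype.ext (he.coind_ext fun x => ?_)
    change he.toCorner x • φ.1.1 e = φ.1.1 x
    rw [← φ.1.2 (he.toCorner x) e]
    have h : φ.1.1 (x * e) = φ.1.1 x := by
      rw [← he.coe_smul_coind, he.smul_fixedPart]
    change φ.1.1 (e * x * e * e) = _
    rw [mul_assoc, he.eq, mul_assoc, he.coind_apply_mul, h]
  right_inv y := by
    change he.toCorner e • y = y
    rw [show he.toCorner e = 1 from Subtype.ext (by
      change e * e * e = e
      rw [he.eq, he.eq]), one_smul]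

end Coind

section Full

variable (he : IsIdempotentElem e) {M N : Type w} [AddCommGroup M] [Module A M] [AddCommGroup N]
  [Module A N] {ι : Type*} [Fintype ι] {x y : ι → A}

theorem sum_smul_of_full (h : ∑ i, x i * e * y i = 1) (m : M) :
    ∑ i, x i • (e * y i) • m = m := by
  simp_rw [smul_smul, ← mul_assoc, ← Finset.sum_smul, h, one_smul]

/-- The extension of a map `e M → e N` to a map `M → N`, when `e` generates the unit ideal. -/
def extendFixedPart (h : ∑ i, x i * e * y i = 1)
    (g : he.fixedPart M →ₗ[he.Corner] he.fixedPart N) : M →ₗ[A] N where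
  -- Forced by `m = ∑ xᵢ (e yᵢ m)`, since each `e yᵢ m` lies in `e M`.
  toFun m := ∑ i, x i • (g ⟨(e * y i) • m, he.smul_mem_fixedPart (by
    rw [← mul_assoc, he.eq]) m⟩).1
  map_add' m m' := by
    rw [← Finset.sum_add_distrib]
    refine Finset.sum_congr rfl fun i _ => ?_
    rw [← smul_add, ← AddSubgroup.coe_add, ← map_add]
    congr 3
    exact Subtype.ext (smul_add _ _ _)
  map_smul' a m := by
    have hy (i : ι) : e * (e * y i) = e * y i := by rw [← mul_assoc, he.eq]
    let G (j : ι) : he.fixedPart N := g ⟨(e * y j) • m, he.smul_mem_fixedPart (hy j) m⟩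
    -- Expanding `m` once more gives `e yᵢ a m = ∑ⱼ (e yᵢ a xⱼ e)(e yⱼ m)`; these coefficients lie
    -- in the corner ring, so `g` commutes with them.
    have key (i : ι) : (g ⟨(e * y i) • a • m, he.smul_mem_fixedPart (hy i) _⟩).1 =
        ∑ j, (e * (y i * a * x j) * e) • (G j).1 := by
      have : (⟨(e * y i) • a • m, he.smul_mem_fixedPart (hy i) _⟩ : he.fixedPart M) =
          ∑ j, he.toCorner (y i * a * x j) •
            (⟨(e * y j) • m, he.smul_mem_fixedPart (hy j) m⟩ : he.fixedPart M) := by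
        refine Subtype.ext ?_
        rw [AddSubgroup.val_finsetSum]
        conv_lhs => rw [← sum_smul_of_full h m]
        simp_rw [Finset.smul_sum]
        refine Finset.sum_congr rfl fun j _ => ?_
        simp_rw [he.coe_corner_smul, toCorner, smul_smul]
        congr 1
        rw [mul_assoc _ e, hy]
        simp only [mul_assoc]
      rw [this, map_sum, AddSubgroup.val_finsetSum]
      simp_rw [map_smul]
      rfl
    change ∑ i, x i • (g ⟨(e * y i) • a • m, he.smul_mem_fixedPart (hy i) _⟩).1 =
      a • ∑ j, x j • (G j).1
    rw [← sum_smul_of_full h (a • ∑ j, x j • (G j).1)]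
    refine Finset.sum_congr rfl fun i _ => ?_
    rw [key]
    simp_rw [Finset.smul_sum]
    refine Finset.sum_congr rfl fun j _ => ?_
    conv_rhs => rw [← he.smul_fixedPart (G j)]
    simp_rw [smul_smul]
    simp only [mul_assoc]

theorem fixedPartMap_extendFixedPart (h : ∑ i, x i * e * y i = 1)
    (g : he.fixedPart M →ₗ[he.Corner] he.fixedPart N) :
    he.fixedPartMap (he.extendFixedPart h g) = g := by
  refine LinearMap.ext fun m => Subtype.ext ?_
  -- On `e M` the fullness identity can be written with coefficients in the corner ring, over which
  -- `g` is linear.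
  have hm : ∑ i, he.toCorner (x i) • he.toCorner (y i) • m = m := by
    refine Subtype.ext ?_
    rw [AddSubgroup.val_finsetSum]
    have : ∑ i, e • x i • (e * y i) • m.1 = m.1 := by
      rw [← Finset.smul_sum, sum_smul_of_full h, he.smul_fixedPart]
    refine Eq.trans (Finset.sum_congr rfl fun i _ => ?_) this
    rw [he.coe_corner_smul, he.coe_corner_smul]
    conv_rhs => rw [← he.smul_fixedPart m]
    simp_rw [toCorner, smul_smul]
    congr 1
    simp only [mul_assoc]
    rw [← mul_assoc e e, he.eq]
  have hg : ∑ i, he.toCorner (x i) • g (he.toCorner (y i) • m) = g m := by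
    conv_rhs => rw [← hm]
    simp_rw [map_sum, map_smul]
  have hF : he.extendFixedPart h g m.1 = e • he.extendFixedPart h g m.1 := by
    rw [← map_smul, he.smul_fixedPart]
  rw [← hg, AddSubgroup.val_finsetSum]
  refine hF.trans (Finset.smul_sum.trans (Finset.sum_congr rfl fun i _ => ?_))
  have hi : (⟨(e * y i) • m.1, he.smul_mem_fixedPart (by rw [← mul_assoc, he.eq]) m.1⟩ :
      he.fixedPart M) = he.toCorner (y i) • m := by
    refine Subtype.ext ?_
    rw [he.coe_corner_smul]
    change (e * y i) • m.1 = (e * y i * e) • m.1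
    rw [mul_smul _ e, he.smul_fixedPart]
  rw [hi, he.coe_corner_smul]
  conv_lhs => rw [← he.smul_fixedPart (g _), smul_smul, smul_smul]
  rfl

theorem fixedPartMap_injective (h : ∑ i, x i * e * y i = 1) :
    Function.Injective (he.fixedPartMap : (M →ₗ[A] N) → _) := by
  intro f f' hf
  refine LinearMap.ext fun m => ?_
  rw [← sum_smul_of_full h m]
  simp_rw [map_sum, map_smul f (x _), map_smul f' (x _)]
  refine Finset.sum_congr rfl fun i _ => congrArg _ ?_
  exact congrArg Subtype.val (LinearMap.congr_fun hf
    ⟨(e * y i) • m, he.smul_mem_fixedPart (by rw [← mul_assoc, he.eq]) m⟩)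

end Full

end Modules

/-! ### The equivalence of module categories. -/

section Category

variable {A : Type v} [Ring A] {e : A} (he : IsIdempotentElem e)

/-- The functor `M ↦ e M` from modules over `A` to modules over the corner ring `e A e`. -/
def fixedPartFunctor : ModuleCat.{w} A ⥤ ModuleCat.{w} he.Corner where
  obj M := ModuleCat.of he.Corner (he.fixedPart M)
  map f := ModuleCat.ofHom (he.fixedPartMap f.hom)
  map_id _ := rfl
  map_comp _ _ := rfl

/-- Fullness of `e` makes the functor fully faithful; essential surjectivity holds for every
idempotent, by coinduction. The universe `max v w` leaves room for the maps from `A` to `N`. -/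
theorem fixedPartFunctor_isEquivalence {ι : Type*} [Fintype ι] {x y : ι → A}
    (h : ∑ i, x i * e * y i = 1) :
    (he.fixedPartFunctor : ModuleCat.{max v w} A ⥤ _).IsEquivalence where
  faithful := ⟨fun {_ _ _ _} hf => ModuleCat.hom_ext
    (he.fixedPartMap_injective h (congrArg ModuleCat.Hom.hom hf))⟩
  full := ⟨fun g => ⟨ModuleCat.ofHom (he.extendFixedPart h g.hom),
    ModuleCat.hom_ext (he.fixedPartMap_extendFixedPart h g.hom)⟩⟩
  essSurj := ⟨fun N => ⟨ModuleCat.of A (he.coind N),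
    ⟨(he.fixedPartCoindEquiv (N := N)).toModuleIso⟩⟩⟩

end Category

open scoped ModuleCat.Algebra in
/-- An algebra is Morita equivalent to its corner at a full idempotent. -/
theorem isMoritaEquivalent_corner {K : Type u} {A : Type v} [Field K] [Ring A] [Algebra K A]
    {e : A} (he : IsIdempotentElem e) {ι : Type*} [Fintype ι] {x y : ι → A}
    (h : ∑ i, x i * e * y i = 1) : IsMoritaEquivalent K A he.Corner := by
  have := he.fixedPartFunctor_isEquivalence.{v, v} h
  refine ⟨⟨⟨(he.fixedPartFunctor : ModuleCat.{v} A ⥤ _).asEquivalence, ⟨?_⟩⟩⟩⟩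
  intro M N f c
  refine ModuleCat.hom_ext (LinearMap.ext fun m => Subtype.ext ?_)
  -- The scalar `c` acts through `c • 1` over `A` and through `c • e` over the corner; these agree
  -- on `e M`.
  change algebraMap K A c • f.hom m.1 = (algebraMap K he.Corner c).1 • f.hom m.1
  rw [Algebra.algebraMap_eq_smul_one, Algebra.algebraMap_eq_smul_one]
  have hm : e • f.hom m.1 = f.hom m.1 := he.smul_fixedPart (he.fixedPartMap f.hom m)
  change (c • (1 : A)) • f.hom m.1 = (c • e) • f.hom m.1
  conv_lhs => rw [← hm, smul_smul, smul_mul_assoc, one_mul]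

end IsIdempotentElem

namespace AffineSchur

/-! ### Orbit sizes. -/

section Orbits

variable {n r : ℕ}

theorem orb_swap_eq_iff {i j k l : Tuple r} :
    orb n j i = orb n l k ↔ orb n i j = orb n k l := by
  simp only [orb_eq_iff, and_comm]

/-- The permutations which are part of some element of the extended affine Weyl group that
fixes `i`. -/
def placeStabilizer (n : ℕ) (i : Tuple r) : Subgroup (Equiv.Perm (Fin r)) where
  carrier := {σ | ∀ t, (n : ℤ) ∣ i t - i (σ t)}
  mul_mem' {σ τ} hσ hτ t := by
    have h := dvd_add (hτ t) (hσ (τ t))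
    rwa [sub_add_sub_cancel] at h
  one_mem' t := by simp
  inv_mem' {σ} hσ t := by
    have h := hσ (σ⁻¹ t)
    rw [show σ (σ⁻¹ t) = t from σ.apply_symm_apply t] at h
    exact (dvd_sub_comm).1 h

-- If `σ ε` fixes `i` and sends `j` to `s`, then `n ε = i - i ∘ σ`, so `s - i = (j - i) ∘ σ`. The
-- set is thus a translate of an orbit of a subgroup of `Σ_r`.
attribute [local instance] arrowAction in
theorem ncard_orb_dvd_factorial (i j : Tuple r) :
    {s | orb n i s = orb n i j}.ncard ∣ r.factorial := by
  have h : {s | orb n i s = orb n i j} =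
      (fun f => f + i) '' MulAction.orbit (placeStabilizer n i) (j - i) := by
    ext s
    constructor
    · intro hs
      obtain ⟨σ, ε, h1, h2⟩ := orb_eq_iff.1 (Eq.symm hs)
      have h1' (t) : i t = i (σ t) + n * ε t := congrFun h1 t
      have h2' (t) : s t = j (σ t) + n * ε t := congrFun h2 t
      -- The inverse appears because `arrowAction` precomposes with the inverse permutation.
      refine ⟨s - i, ⟨(⟨σ, fun t => ⟨ε t, by rw [h1' t]; ring⟩⟩ : placeStabilizer n i)⁻¹, ?_⟩,
        sub_add_cancel s i⟩
      funext t
      change (j - i) (σ t) = s t - i t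
      rw [h2', Pi.sub_apply]
      linarith [h1' t]
    · rintro ⟨_, ⟨σ, rfl⟩, rfl⟩
      choose ε hε using (σ⁻¹).2
      refine (orb_eq_iff.2 ⟨(σ⁻¹).1, ε, ?_, ?_⟩).symm
      · funext t
        change i t = i ((σ⁻¹).1 t) + n * ε t
        linarith [hε t]
      · funext t
        change (j ((σ⁻¹).1 t) - i ((σ⁻¹).1 t)) + i t = j ((σ⁻¹).1 t) + n * ε t
        linarith [hε t]
  rw [h, Set.ncard_image_of_injective _ (add_left_injective i), ← MulAction.index_stabilizer]
  refine (Subgroup.index_dvd_card _).trans ?_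
  have hd := Subgroup.card_subgroup_dvd_card (placeStabilizer n i)
  rwa [Nat.card_perm, Nat.card_fin] at hd

end Orbits

/-! ### Products of basis elements and the identity. -/

section Products

variable (K : Type*) [Field K] {n r : ℕ} [NeZero n]

theorem xi_mul_xi_self (i j : Tuple r) : (xi K i j * xi K j j : SchurAlgebra K n r) = xi K i j := by
  classical
  refine (xi_mul_xi K i j j j).trans (ext_coeff fun c => ?_)
  obtain ⟨p, q, rfl⟩ := exists_orb c
  rw [coeff_basisMul, structConst_orb, xi, coeff_basisElt]
  have hs : middleSet (orb n i j) (orb n j j) p q = if orb n i j = orb n p q then {q} else ∅ := by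
    ext s
    have hd (h : orb n s q = orb n j j) : s = q := orb_mem_diagonal.1 ⟨j, h.symm⟩
    split_ifs with h
    · refine ⟨fun hs => hd hs.2, ?_⟩
      rintro rfl
      obtain ⟨σ, ε, h1, h2⟩ := orb_eq_iff.1 h
      exact ⟨h.symm, by rw [h2, orb_act]⟩
    · refine ⟨fun hs => h ?_, fun hs => hs.elim⟩
      rw [← hd hs.2]
      exact hs.1.symm
  rw [hs]
  split_ifs <;> simp

/-- The hypothesis says that the stabilizer of `j` is contained in that of `i`. A middle tuple `s =
w j` then determines both outer tuples as `w i`, so only the diagonal orbit of `i` occurs. -/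
theorem xi_mul_xi_swap {i j : Tuple r}
    (h : ∀ σ ε τ δ, act n σ ε j = act n τ δ j → act n σ ε i = act n τ δ i) :
    (xi K i j * xi K j i : SchurAlgebra K n r) =
      ({s | orb n i s = orb n i j}.ncard : K) • xi K i i := by
  classical
  refine (xi_mul_xi K i j j i).trans (ext_coeff fun c => ?_)
  change _ = ({s | orb n i s = orb n i j}.ncard : K) * coeff (xi K i i) c
  rw [coeff_basisMul, xi, coeff_basisElt]
  split_ifs with hc
  · rw [← hc, structConst_orb, mul_one]
    -- At `(i, i)` the two conditions on `s` are equivalent by swapping the pairs.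
    congr 2
    ext s
    exact ⟨fun hs => hs.1, fun hs => ⟨hs, orb_swap_eq_iff.2 hs⟩⟩
  · obtain ⟨p, q, rfl⟩ := exists_orb c
    have hs : middleSet (orb n i j) (orb n j i) p q = ∅ := by
      refine Set.eq_empty_of_forall_notMem fun s hs => hc ?_
      obtain ⟨σ, ε, h1, h2⟩ := orb_eq_iff.1 hs.1.symm
      obtain ⟨τ, δ, h3, h4⟩ := orb_eq_iff.1 hs.2.symm
      rw [h4, ← h _ _ _ _ (h2.symm.trans h3), ← h1]
      rw [h1, orb_act]
    rw [structConst_orb, hs]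
    simp

/-- Representatives are left free so that they can later be taken with equal first two entries. -/
theorem one_eq_sum_xi {i : Orbit n r → Tuple r}
    (hi : ∀ c ∈ diagonal n r, orb n (i c) (i c) = c) :
    (1 : SchurAlgebra K n r) = ∑ c : (finite_diagonal n r).toFinset, xi K (i c) (i c) := by
  classical
  have h : ∑ c : (finite_diagonal n r).toFinset, (xi K (i c) (i c) : SchurAlgebra K n r) =
      ∑ c ∈ (finite_diagonal n r).toFinset, basisElt K c := by
    rw [← Finset.sum_coe_sort _ (basisElt K)]
    refine Finset.sum_congr rfl fun c _ => ?_
    rw [xi, hi _ ((finite_diagonal n r).mem_toFinset.1 c.2)]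
  rw [h]
  refine ext_coeff fun d => ?_
  let F : SchurAlgebra K n r →+ K :=
    { toFun := fun f => coeff f d
      map_zero' := rfl
      map_add' := fun _ _ => rfl }
  have hF : F (∑ c ∈ (finite_diagonal n r).toFinset, basisElt K c) =
      ∑ c ∈ (finite_diagonal n r).toFinset, coeff (basisElt K c) d := map_sum F _ _
  refine Eq.trans ?_ hF.symm
  change (if d ∈ diagonal n r then (1 : K) else 0) = _
  simp [coeff_basisElt]

end Products

/-! ### Stabilizer of `v`, and good orbit representatives. -/

section VTuple

variable {n : ℕ}

/-- The entries of `v` lie in `1, …, n`, so they differ by less than `n` and the shifts must agree.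
The permutations can then differ only between places `0` and `1`, where `v` repeats its value and
`i` is constant. -/
theorem act_eq_of_act_vTuple_eq {i : Tuple (n + 1)}
    (hi : ∀ a b : Fin (n + 1), (a : ℕ) ≤ 1 → (b : ℕ) ≤ 1 → i a = i b)
    (σ : Equiv.Perm (Fin (n + 1))) (ε : Fin (n + 1) → ℤ) (τ : Equiv.Perm (Fin (n + 1)))
    (δ : Fin (n + 1) → ℤ) (h : act n σ ε (vTuple n) = act n τ δ (vTuple n)) :
    act n σ ε i = act n τ δ i := by
  funext t
  have ht : vTuple n (σ t) + n * ε t = vTuple n (τ t) + n * δ t := congrFun h t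
  change i (σ t) + n * ε t = i (τ t) + n * δ t
  simp only [vTuple] at ht
  rcases Nat.eq_zero_or_pos n with rfl | hn
  · have : σ t = τ t := Subsingleton.elim (α := Fin 1) _ _
    simp [this]
  have hs := (σ t).2
  have hs' := (τ t).2
  have hεδ : ε t = δ t := by
    have hn' : (0 : ℤ) < n := by exact_mod_cast hn
    rcases lt_trichotomy (ε t) (δ t) with hlt | heq | hlt
    · have := mul_le_mul_of_nonneg_left (Int.add_one_le_iff.2 hlt) hn'.le
      rw [mul_add] at this
      omega
    · exact heq
    · have := mul_le_mul_of_nonneg_left (Int.add_one_le_iff.2 hlt) hn'.le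
      rw [mul_add] at this
      omega
  rw [hεδ] at ht ⊢
  congr 1
  by_cases h1 : (σ t : ℕ) ≤ 1
  · exact hi _ _ h1 (by omega)
  · exact congrArg i (Fin.ext (by omega))

theorem exists_orb_diagonal_eq [NeZero n] (j : Tuple (n + 1)) : ∃ i : Tuple (n + 1),
    orb n i i = orb n j j ∧
      ∀ a b : Fin (n + 1), (a : ℕ) ≤ 1 → (b : ℕ) ≤ 1 → i a = i b := by
  obtain ⟨a, b, hab, hj⟩ := Fintype.exists_ne_map_eq_of_card_lt
    (fun t => (j t : ZMod n)) (by simp [ZMod.card])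
  obtain ⟨d, hd⟩ := (ZMod.intCast_eq_intCast_iff_dvd_sub _ _ _).1 hj.symm
  have hn := NeZero.pos n
  let o : Fin (n + 1) := ⟨1, by omega⟩
  have ho : (0 : Fin (n + 1)) ≠ o := fun h => by simpa [o] using congrArg Fin.val h
  -- `σ` sends places `0`, `1` to the congruent places `a`, `b`; shifting place `1` by `d = (j a - j
  -- b) / n` then makes the two entries equal.
  let σ := Equiv.swap 0 a * Equiv.swap o (Equiv.swap 0 a b)
  have hσ0 : σ 0 = a := by
    have : Equiv.swap 0 a b ≠ 0 := fun h => hab (by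
      simpa using (congrArg (Equiv.swap 0 a) h).symm)
    simp [σ, Equiv.swap_apply_of_ne_of_ne ho this.symm]
  have hσ1 : σ o = b := by simp [σ]
  refine ⟨act n σ (fun t => if t = o then d else 0) j, orb_act _ _ _ _, ?_⟩
  have key : act n σ (fun t => if t = o then d else 0) j 0 =
      act n σ (fun t => if t = o then d else 0) j o := by
    simp only [act, hσ0, hσ1, if_neg ho, if_true]
    linarith
  have hcase (c : Fin (n + 1)) (hc : (c : ℕ) ≤ 1) : c = 0 ∨ c = o := by
    rcases Nat.le_one_iff_eq_zero_or_eq_one.1 hc with h | h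
    · exact Or.inl (Fin.ext h)
    · exact Or.inr (Fin.ext h)
  intro c c' hc hc'
  rcases hcase c hc with rfl | rfl <;> rcases hcase c' hc' with rfl | rfl <;>
    first | rfl | exact key | exact key.symm

end VTuple

theorem natCast_ne_zero_of_dvd_factorial {K : Type*} [Field K] {m N : ℕ}
    (hK : ringChar K = 0 ∨ m < ringChar K) (hN : N ∣ m.factorial) : (N : K) ≠ 0 := by
  intro h
  have hd := ((ringChar.spec K N).1 h).trans hN
  rcases hK with h0 | hlt
  · rw [h0, zero_dvd_iff] at hd
    exact m.factorial_ne_zero hd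
  · have hp : (ringChar K).Prime :=
      (CharP.char_is_prime_or_zero K (ringChar K)).resolve_right (by omega)
    exact absurd (hp.dvd_factorial.1 hd) (by omega)

end AffineSchur

theorem mainTheorem5 {K : Type*} [Field K] [Infinite K] (n : ℕ) [NeZero n]
    (hK : ringChar K = 0 ∨ n + 1 < ringChar K) :
    IsMoritaEquivalent K (AffineSchur.SchurAlgebra K n (n + 1))
      (AffineSchur.Centralizer K (n := n) (AffineSchur.vTuple n)) := by
  open AffineSchur in
  have hrep (c : Orbit n (n + 1)) : ∃ i : Tuple (n + 1), (c ∈ diagonal n (n + 1) → orb n i i = c) ∧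
      ∀ a b : Fin (n + 1), (a : ℕ) ≤ 1 → (b : ℕ) ≤ 1 → i a = i b := by
    by_cases hc : c ∈ diagonal n (n + 1)
    · obtain ⟨j, rfl⟩ := hc
      obtain ⟨i, hi, hi'⟩ := exists_orb_diagonal_eq (n := n) j
      exact ⟨i, fun _ => hi, hi'⟩
    -- Off the diagonal the zero tuple is a dummy value.
    · exact ⟨0, fun h => absurd h hc, fun _ _ _ _ => rfl⟩
  choose i hi hi' using hrep
  let N (c : Orbit n (n + 1)) : ℕ := {s | orb n (i c) s = orb n (i c) (vTuple n)}.ncard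
  have hN (c) : (N c : K) ≠ 0 := natCast_ne_zero_of_dvd_factorial hK (ncard_orb_dvd_factorial _ _)
  refine (xi_idempotent K (n := n) (vTuple n)).isMoritaEquivalent_corner
    (ι := (finite_diagonal n (n + 1)).toFinset)
    (x := fun c => (N c : K)⁻¹ • xi K (i c) (vTuple n)) (y := fun c => xi K (vTuple n) (i c)) ?_
  rw [one_eq_sum_xi K hi]
  refine Finset.sum_congr rfl fun c _ => ?_
  -- The middle factor `ξ_{v,v}` is absorbed into `ξ_{i,v}`, and `N⁻¹` cancels the orbit size.
  rw [smul_mul_assoc, smul_mul_assoc, xi_mul_xi_self,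
    xi_mul_xi_swap K (act_eq_of_act_vTuple_eq (hi' c)), smul_smul, inv_mul_cancel₀ (hN c), one_smul]
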